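/- **Setting.** Let $\mathbb R\langle x_1,\dots,x_g\rangle$ be the free real algebra, with transpose $p\mapsto p^T$ reversing the letters of each monomial and fixing the variables and scalars; $p$ is symmetric if $p^T=p$. For a further free variable $h$, also with $h^T=h$, put $D[p,x_i,h]=\frac{d}{dt}p(x_1,\dots,x_i+th,\dots,x_g)|_{t=0}$ ($t$ a central scalar, $h$ treated as constant) and $\mathrm{Lap}[p,h]=\sum_{i=1}^g D[D[p,x_i,h],x_i,h]$. A symmetric polynomial $q(x,h)$ is matrix positive if $q(X_1,\dots,X_g,H)$ is positive semidefinite for all $n$ and all real symmetric $n\times n$ matrices $X_1,\dots,X_g,H$. A polynomial $p$ is harmonic if $\mathrm{Lap}[p,h]=0$ and subharmonic if $\mathrm{Lap}[p,h]$ is symmetric and matrix positive. It is homogeneous of degree $m$ if all its monomials have degree $m$ (so $0$ is homogeneous of every degree). **Proposition.** Let $d\ge 0$ be even. Suppose the space of harmonic polynomials in $x_1,\dots,x_g$ homogeneous of degree $d/2$ is the span of $\gamma_1,\dots,\gamma_k$, and that for every $j$ there is a monomial $w_j$ occurring in $\gamma_j$ but in no $\gamma_i$ with $i\ne j$. Then: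 1. Every subharmonic $p$ homogeneous of degree $d$ has the form $p=\sum_{i,j=1}^k\phi_{ij}\,\gamma_i\gamma_j$ with $\phi_{ij}\in\mathbb R$. 2. If moreover $p$ is symmetric, then $p=\sum_{i,j=1}^k\phi_{ij}\,\gamma_i^T\gamma_j$ with real $\phi_{ij}=\phi_{ji}$. In particular, if every $\gamma_i$ is symmetric, then $p=\sum_{i,j=1}^k\phi_{ij}\,\gamma_i\gamma_j$ with real $\phi_{ij}=\phi_{ji}$. 3. The span $\mathcal S$ of the symmetric subharmonic polynomials homogeneous of degree $d$ has dimension at most $\frac{k(k+1)}2$. In two variables ($g=2$), for every $m\ge1$ with $m\neq2$, the space of harmonic polynomials homogeneous of degree $m$ has dimension exactly $2$; and for every even $d\ge 0$ the span $\mathcal S$ of the symmetric subharmonic polynomials homogeneous of degree $d$ has dimension at most $3$ if $d\ne4$, and at most $6$ if $d=4$. -/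

import Mathlib

noncomputable section

/-- Noncommutative real polynomials in variables indexed by `σ`. The transpose of a polynomial
(reverse every monomial, fix every variable and every scalar) is Mathlib's `star` on the
free algebra. -/
abbrev NCPoly (σ : Type) : Type := FreeAlgebra ℝ σ

namespace NCPoly

/-- The coefficient in `p` of the monomial (word) `w`. -/
def coeff {σ : Type} (w : FreeMonoid σ) (p : NCPoly σ) : ℝ :=
  (FreeAlgebra.equivMonoidAlgebraFreeMonoid p).coeff w

/-- All monomials occurring in `p` have degree `m` (the zero polynomial qualifies). -/
def IsHomogeneous {σ : Type} (p : NCPoly σ) (m : ℕ) : Prop :=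
  ∀ w : FreeMonoid σ, coeff w p ≠ 0 → w.length = m

/-- A polynomial is symmetric if it equals its transpose. -/
def IsSymmetric {σ : Type} (p : NCPoly σ) : Prop := star p = p

/-- A symmetric polynomial is matrix positive if its value at every tuple of real symmetric
matrices of the same size is positive semidefinite. -/
def IsMatrixPositive {σ : Type} (q : NCPoly σ) : Prop :=
  IsSymmetric q ∧ ∀ (n : ℕ) (X : σ → Matrix (Fin n) (Fin n) ℝ),
    (∀ s, (X s).IsSymm) → (FreeAlgebra.lift ℝ X q).PosSemidef

/-- In the variables `some 0, …, some (g - 1)` (the variables `x`) and `none` (the direction `h`),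
the substitution `x_i ↦ x_i + t h`, all other variables being fixed; the values are
polynomials in a central indeterminate `t`. -/
def shift {g : ℕ} (i : Fin g) :
    NCPoly (Option (Fin g)) →ₐ[ℝ] Polynomial (NCPoly (Option (Fin g))) :=
  FreeAlgebra.lift ℝ fun s =>
    Polynomial.C (FreeAlgebra.ι ℝ s) +
      if s = some i then Polynomial.X * Polynomial.C (FreeAlgebra.ι ℝ none) else 0

/-- The directional derivative in `x_i` in the direction `h`: the derivative at `t = 0` of
`p (x_1, …, x_i + t h, …, x_g)`. -/
def dirDeriv {g : ℕ} (i : Fin g) (p : NCPoly (Option (Fin g))) : NCPoly (Option (Fin g)) :=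
  (Polynomial.derivative (shift i p)).eval 0

/-- A polynomial in `x_1, …, x_g`, regarded as a polynomial in `x_1, …, x_g, h`. -/
def inclX {g : ℕ} : NCPoly (Fin g) →ₐ[ℝ] NCPoly (Option (Fin g)) :=
  FreeAlgebra.lift ℝ fun i => FreeAlgebra.ι ℝ (some i)

/-- The noncommutative Laplacian, a polynomial in `x_1, …, x_g` and `h`. -/
def lap {g : ℕ} (p : NCPoly (Fin g)) : NCPoly (Option (Fin g)) :=
  ∑ i : Fin g, dirDeriv i (dirDeriv i (inclX p))

def IsHarmonic {g : ℕ} (p : NCPoly (Fin g)) : Prop := lap p = 0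

def IsSubharmonic {g : ℕ} (p : NCPoly (Fin g)) : Prop := IsMatrixPositive (lap p)

theorem coeff_add {σ : Type} (w : FreeMonoid σ) (p q : NCPoly σ) :
    coeff w (p + q) = coeff w p + coeff w q := by
  simp [coeff]

theorem coeff_smul {σ : Type} (w : FreeMonoid σ) (c : ℝ) (p : NCPoly σ) :
    coeff w (c • p) = c * coeff w p := by
  simp [coeff]

theorem coeff_zero {σ : Type} (w : FreeMonoid σ) : coeff w (0 : NCPoly σ) = 0 := by
  simp [coeff]

theorem dirDeriv_add {g : ℕ} (i : Fin g) (p q : NCPoly (Option (Fin g))) :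
    dirDeriv i (p + q) = dirDeriv i p + dirDeriv i q := by
  simp [dirDeriv]

theorem dirDeriv_smul {g : ℕ} (i : Fin g) (c : ℝ) (p : NCPoly (Option (Fin g))) :
    dirDeriv i (c • p) = c • dirDeriv i p := by
  simp [dirDeriv, Polynomial.eval_smul]

theorem lap_add {g : ℕ} (p q : NCPoly (Fin g)) : lap (p + q) = lap p + lap q := by
  simp [lap, dirDeriv_add, Finset.sum_add_distrib]

theorem lap_smul {g : ℕ} (c : ℝ) (p : NCPoly (Fin g)) : lap (c • p) = c • lap p := by
  simp [lap, dirDeriv_smul, Finset.smul_sum]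

/-- The space of harmonic polynomials in `g` variables that are homogeneous of degree `m`. -/
def harmonics (g m : ℕ) : Submodule ℝ (NCPoly (Fin g)) where
  carrier := {p | IsHomogeneous p m ∧ IsHarmonic p}
  zero_mem' := by
    refine ⟨fun w hw => absurd (coeff_zero w) hw, ?_⟩
    have h := lap_smul (g := g) 0 0
    simpa [IsHarmonic] using h
  add_mem' := by
    rintro p q ⟨hp, hp'⟩ ⟨hq, hq'⟩
    refine ⟨fun w hw => ?_, ?_⟩
    · by_contra hne
      have h1 : coeff w p = 0 := by_contra fun h => hne (hp w h)
      have h2 : coeff w q = 0 := by_contra fun h => hne (hq w h)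
      exact hw (by rw [coeff_add, h1, h2, add_zero])
    · unfold IsHarmonic at *
      rw [lap_add, hp', hq', add_zero]
  smul_mem' := by
    rintro c p ⟨hp, hp'⟩
    refine ⟨fun w hw => hp w fun h => hw (by rw [coeff_smul, h, mul_zero]), ?_⟩
    unfold IsHarmonic at *
    rw [lap_smul, hp', smul_zero]

/-- For every `j` some monomial occurs in `γ j` and in no other `γ i`. -/
def HasPrivateMonomials {σ : Type} {k : ℕ} (γ : Fin k → NCPoly σ) : Prop :=
  ∀ j, ∃ w : FreeMonoid σ, coeff w (γ j) ≠ 0 ∧ ∀ i, i ≠ j → coeff w (γ i) = 0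

/-- The span of the symmetric subharmonic polynomials in `g` variables that are
homogeneous of degree `d`. -/
def symmSubharmonicSpan (g d : ℕ) : Submodule ℝ (NCPoly (Fin g)) :=
  Submodule.span ℝ {p | IsHomogeneous p d ∧ IsSymmetric p ∧ IsSubharmonic p}

end NCPoly

end

noncomputable section

namespace NCPoly

/-! The coefficient of `Lap[p,h]` at `u h v h w` is twice the contraction `∑ i, cf (u i v i w) p`,
and no other words occur in the Laplacian (`cf_hhWord_lap`, `exists_hhWord_of_cf_lap_ne_zero`). So
harmonicity means that all contractions of the coefficients vanish.

Matrix positivity kills the contractions lying inside one half of a word. For a word `W` of length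
`d`, take a path with edges labelled by `W` and evaluate at the adjacency matrices of the labels.
The entry between the two ends is the coefficient of `W`. If no `h` labels the second half, a closed
walk of length `d` at the far end cannot reach an `h` edge and return, so that diagonal entry is
zero, and semidefiniteness makes its whole column zero (`IsMatrixPositive.cf_eq_zero`).

Hence, for `d = 2 * m`, fixing either half of a word leaves coefficients of a harmonic polynomial of
degree `m` in the other half. Interpolating both halves at private monomials writes `p` through
products of harmonics (`eq_sum_of_contractions_eq_zero`). With transposed left factors and reversed
private words, symmetry of `p` makes the coefficient matrix symmetric, which gives the dimension
bound.

In two variables a contraction trades a pair of letters `1` for a pair of letters `0` with a sign,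
so few coefficients determine a harmonic polynomial; the real and imaginary parts of `(x_0 + i x_1)
^ m` realize them, except that degree 2 has one more dimension. -/

open Polynomial in
theorem dirDeriv_eq_coeff_one {g : ℕ} (i : Fin g) (p : NCPoly (Option (Fin g))) :
    dirDeriv i p = (shift i p).coeff 1 := by
  rw [dirDeriv, ← Polynomial.coeff_zero_eq_eval_zero, Polynomial.coeff_derivative]
  simp

/-! ### Words, coefficients and homogeneity -/

/-- The monomial with the given list of letters. -/
def word {σ : Type} (l : List σ) : NCPoly σ := (l.map (FreeAlgebra.ι ℝ)).prod

@[simp] theorem word_nil {σ : Type} : word ([] : List σ) = 1 := by simp [word]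

@[simp] theorem word_cons {σ : Type} (s : σ) (l : List σ) :
    word (s :: l) = FreeAlgebra.ι ℝ s * word l := by simp [word]

theorem word_append {σ : Type} (l l' : List σ) : word (l ++ l') = word l * word l' := by
  simp [word]

theorem star_word {σ : Type} (l : List σ) : star (word l) = word l.reverse := by
  induction l with
  | nil => simp
  | cons s l ih => simp [ih, word_append]

theorem equiv_word {σ : Type} (l : List σ) :
    FreeAlgebra.equivMonoidAlgebraFreeMonoid (R := ℝ) (word l) =
      MonoidAlgebra.single (FreeMonoid.ofList l) 1 := by
  induction l with
  | nil => simp [MonoidAlgebra.one_def]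
  | cons s l ih =>
    rw [word_cons, map_mul, ih]
    simp [FreeAlgebra.equivMonoidAlgebraFreeMonoid, MonoidAlgebra.single_mul_single]

/-- The coefficient at a list of letters, as a linear functional. -/
def cf {σ : Type} (l : List σ) : NCPoly σ →ₗ[ℝ] ℝ where
  toFun p := coeff (FreeMonoid.ofList l) p
  map_add' := coeff_add _
  map_smul' := coeff_smul _

open Classical in
theorem cf_word {σ : Type} (l l' : List σ) : cf l (word l') = if l = l' then 1 else 0 := by
  change (FreeAlgebra.equivMonoidAlgebraFreeMonoid (word l')).coeff (FreeMonoid.ofList l) = _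
  rw [equiv_word, MonoidAlgebra.coeff_single, Finsupp.single_apply]
  simp [eq_comm]

theorem ext_cf {σ : Type} {p q : NCPoly σ} (h : ∀ l, cf l p = cf l q) : p = q := by
  apply FreeAlgebra.equivMonoidAlgebraFreeMonoid.injective
  ext w
  exact h w.toList

theorem induction_word {σ : Type} {P : NCPoly σ → Prop} (hw : ∀ l, P (word l))
    (hadd : ∀ p q, P p → P q → P (p + q)) (hsmul : ∀ (c : ℝ) p, P p → P (c • p))
    (p : NCPoly σ) : P p := by
  have key : ∀ x : MonoidAlgebra ℝ (FreeMonoid σ),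
      P (FreeAlgebra.equivMonoidAlgebraFreeMonoid.symm x) := by
    intro x
    induction x using MonoidAlgebra.induction_linear with
    | zero => simpa using hsmul 0 _ (hw [])
    | add x y hx hy => simpa using hadd _ _ hx hy
    | single w r =>
      have h := hsmul r _ (hw w.toList)
      have e : MonoidAlgebra.single w r = r • MonoidAlgebra.single w (1 : ℝ) := by simp
      rw [e, map_smul]
      have e2 := equiv_word w.toList
      rw [FreeMonoid.ofList_toList] at e2
      rwa [← e2, AlgEquiv.symm_apply_apply]
  simpa using key (FreeAlgebra.equivMonoidAlgebraFreeMonoid p)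

theorem eq_zero_of_isHomogeneous {σ : Type} {p : NCPoly σ} {m : ℕ} (hp : p.IsHomogeneous m)
    {l : List σ} (hl : l.length ≠ m) : cf l p = 0 := by
  by_contra h
  exact hl (hp (FreeMonoid.ofList l) h)

theorem isHomogeneous_iff {σ : Type} {p : NCPoly σ} {m : ℕ} :
    p.IsHomogeneous m ↔ ∀ l, cf l p ≠ 0 → l.length = m := Iff.rfl

theorem cf_star {σ : Type} (l : List σ) (p : NCPoly σ) : cf l (star p) = cf l.reverse p := by
  induction p using induction_word with
  | hw l' =>
    classical
    rw [star_word, cf_word, cf_word]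
    congr 1
    rw [eq_iff_iff, List.reverse_eq_iff]
  | hadd p q hp hq => simp [hp, hq]
  | hsmul c p hp =>
    have : star (c • p) = c • star p := by
      rw [Algebra.smul_def, star_mul, FreeAlgebra.star_algebraMap, ← Algebra.commutes,
        ← Algebra.smul_def]
    simp [this, hp]

theorem exists_sum_word {σ : Type} (p : NCPoly σ) :
    ∃ S : Finset (List σ), p = ∑ l ∈ S, cf l p • word l ∧ ∀ l ∈ S, cf l p ≠ 0 := by
  classical
  let S : Finset (List σ) := (FreeAlgebra.equivMonoidAlgebraFreeMonoid p).coeff.support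
  have hS : ∀ l, l ∈ S ↔ cf l p ≠ 0 := fun l => Finsupp.mem_support_iff
  refine ⟨S, ext_cf fun l => ?_, fun l hl => (hS l).1 hl⟩
  simp only [map_sum, map_smul, cf_word, smul_eq_mul, mul_ite, mul_one, mul_zero]
  rw [Finset.sum_ite_eq]
  split_ifs with h
  · rfl
  · exact not_not.1 fun h' => h ((hS l).2 h')

theorem cf_append_word_mul {σ : Type} (b : NCPoly σ) {u l : List σ} (hu : u.length = l.length)
    (v : List σ) : cf (u ++ v) (word l * b) = cf u (word l) * cf v b := by
  classical
  induction b using induction_word with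
  | hw l' =>
    rw [← word_append]
    have e : u ++ v = l ++ l' ↔ u = l ∧ v = l' :=
      ⟨fun h => List.append_inj h hu, fun ⟨h, h'⟩ => by rw [h, h']⟩
    simp only [cf_word, e]
    by_cases h : u = l <;> by_cases h' : v = l' <;> simp [h, h']
  | hadd p q hp hq => simp [mul_add, hp, hq]
  | hsmul c p hp => simp only [mul_smul_comm, map_smul, hp, smul_eq_mul]; ring

/-- Homogeneity of the left factor fixes where a word of the product splits, so the convolution has
a single term. -/
theorem cf_append_mul {σ : Type} {m : ℕ} {a : NCPoly σ} (ha : a.IsHomogeneous m) (b : NCPoly σ)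
    {u : List σ} (hu : u.length = m) (v : List σ) : cf (u ++ v) (a * b) = cf u a * cf v b := by
  obtain ⟨S, hS, hS0⟩ := exists_sum_word a
  have h : ∀ l ∈ S, cf (u ++ v) (word l * b) = cf u (word l) * cf v b := fun l hl =>
    cf_append_word_mul b (hu.trans (ha l (hS0 l hl)).symm) v
  conv_lhs => rw [hS]
  conv_rhs => rw [hS]
  rw [Finset.sum_mul, map_sum, map_sum, Finset.sum_mul]
  refine Finset.sum_congr rfl fun l hl => ?_
  simp only [smul_mul_assoc, map_smul, smul_eq_mul, h l hl, mul_assoc]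

theorem isHomogeneous_mul {σ : Type} {m n : ℕ} {a b : NCPoly σ} (ha : a.IsHomogeneous m)
    (hb : b.IsHomogeneous n) : (a * b).IsHomogeneous (m + n) := by
  classical
  rw [isHomogeneous_iff]
  intro w hw
  obtain ⟨S, hS, hS0⟩ := exists_sum_word a
  obtain ⟨T, hT, hT0⟩ := exists_sum_word b
  by_contra hne
  apply hw
  rw [hS, hT, Finset.sum_mul, map_sum]
  refine Finset.sum_eq_zero fun l hl => ?_
  rw [Finset.mul_sum, map_sum]
  refine Finset.sum_eq_zero fun l' hl' => ?_
  have h1 : l.length = m := ha l (hS0 l hl)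
  have h2 : l'.length = n := hb l' (hT0 l' hl')
  have h3 : w ≠ l ++ l' := by
    rintro rfl
    exact hne (by simp [h1, h2])
  simp [← word_append, cf_word, h3]

theorem isHomogeneous_smul {σ : Type} {m : ℕ} {a : NCPoly σ} (ha : a.IsHomogeneous m) (c : ℝ) :
    (c • a).IsHomogeneous m := by
  rw [isHomogeneous_iff]
  intro l hl
  exact ha l (right_ne_zero_of_mul (a := c) (b := cf l a) (by rwa [map_smul] at hl))

theorem isHomogeneous_sum {σ ι : Type} {m : ℕ} (s : Finset ι) {f : ι → NCPoly σ}
    (hf : ∀ i ∈ s, (f i).IsHomogeneous m) : (∑ i ∈ s, f i).IsHomogeneous m := by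
  rw [isHomogeneous_iff]
  intro l hl
  rw [map_sum] at hl
  obtain ⟨i, hi, h⟩ := Finset.exists_ne_zero_of_sum_ne_zero hl
  exact hf i hi l h

theorem isHomogeneous_star {σ : Type} {m : ℕ} {a : NCPoly σ} (ha : a.IsHomogeneous m) :
    (star a).IsHomogeneous m := by
  rw [isHomogeneous_iff]
  intro l hl
  rw [cf_star] at hl
  simpa using isHomogeneous_iff.1 ha _ hl

/-! ### Coefficients of the Laplacian -/

/-- With this constant term, the linear coefficient in `t` of a product is the Leibniz rule. -/
theorem coeff_zero_shift {g : ℕ} (i : Fin g) (p : NCPoly (Option (Fin g))) :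
    (shift i p).coeff 0 = p := by
  induction p using induction_word with
  | hw l =>
    induction l with
    | nil => simp
    | cons s l ih =>
      rw [word_cons, map_mul, Polynomial.mul_coeff_zero, ih, shift, FreeAlgebra.lift_ι_apply]
      split_ifs <;> simp
  | hadd p q hp hq => simp [hp, hq]
  | hsmul c p hp => simp [hp]

theorem dirDeriv_one {g : ℕ} (i : Fin g) : dirDeriv i 1 = 0 := by
  simp [dirDeriv]

theorem dirDeriv_mul {g : ℕ} (i : Fin g) (p q : NCPoly (Option (Fin g))) :
    dirDeriv i (p * q) = p * dirDeriv i q + dirDeriv i p * q := by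
  simp only [dirDeriv_eq_coeff_one, map_mul, Polynomial.mul_coeff_one, coeff_zero_shift]

theorem dirDeriv_ι {g : ℕ} (i : Fin g) (s : Option (Fin g)) :
    dirDeriv i (FreeAlgebra.ι ℝ s) = if s = some i then FreeAlgebra.ι ℝ none else 0 := by
  rw [dirDeriv, shift, FreeAlgebra.lift_ι_apply]
  split_ifs <;> simp

/-- The sum of the values of `f` at the words obtained from a word by replacing one letter `h`
with `x_i`. -/
def replaceSum {g : ℕ} (i : Fin g) :
    List (Option (Fin g)) → (List (Option (Fin g)) → ℝ) → ℝ
  | [], _ => 0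
  | s :: W, f => replaceSum i W (fun l => f (s :: l)) + if s = none then f (some i :: W) else 0

theorem replaceSum_add {g : ℕ} (i : Fin g) (W : List (Option (Fin g)))
    (f f' : List (Option (Fin g)) → ℝ) :
    replaceSum i W (fun l => f l + f' l) = replaceSum i W f + replaceSum i W f' := by
  induction W generalizing f f' with
  | nil => simp [replaceSum]
  | cons s W ih =>
    simp only [replaceSum, ih]
    split_ifs <;> ring

theorem replaceSum_smul {g : ℕ} (i : Fin g) (W : List (Option (Fin g))) (c : ℝ)
    (f : List (Option (Fin g)) → ℝ) :
    replaceSum i W (fun l => c * f l) = c * replaceSum i W f := by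
  induction W generalizing f with
  | nil => simp [replaceSum]
  | cons s W ih =>
    simp only [replaceSum, ih]
    split_ifs <;> ring

theorem replaceSum_zero {g : ℕ} (i : Fin g) (W : List (Option (Fin g))) :
    replaceSum i W (fun _ => 0) = 0 := by
  simpa using replaceSum_smul i W 0 fun _ => 0

theorem cf_nil_ι_mul {σ : Type} (t : σ) (p : NCPoly σ) :
    cf [] (FreeAlgebra.ι ℝ t * p) = 0 := by
  classical
  induction p using induction_word with
  | hw l => rw [← word_cons, cf_word]; simp
  | hadd p q hp hq => simp [mul_add, hp, hq]
  | hsmul c p hp => simp [hp]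

open Classical in
theorem cf_cons_ι_mul {σ : Type} (s t : σ) (l : List σ) (p : NCPoly σ) :
    cf (s :: l) (FreeAlgebra.ι ℝ t * p) = if s = t then cf l p else 0 := by
  induction p using induction_word with
  | hw l' =>
    rw [← word_cons, cf_word, cf_word]
    by_cases h : s = t <;> simp [h]
  | hadd p q hp hq =>
    rw [mul_add, map_add, hp, hq]
    split_ifs <;> simp
  | hsmul c p hp =>
    rw [mul_smul_comm, map_smul, hp]
    split_ifs <;> simp

/-- Differentiation turns one `x_i` into `h`; dually, a coefficient of the derivative collects the
words in which one `h` is turned back. -/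
theorem cf_dirDeriv {g : ℕ} (i : Fin g) (W : List (Option (Fin g)))
    (p : NCPoly (Option (Fin g))) :
    cf W (dirDeriv i p) = replaceSum i W fun l => cf l p := by
  classical
  induction p using induction_word with
  | hw l =>
    induction l generalizing W with
    | nil =>
      rw [word_nil, dirDeriv_one, map_zero]
      have h1 : ∀ (s : Option (Fin g)) l, cf (s :: l) (1 : NCPoly (Option (Fin g))) = 0 := by
        intro s l
        rw [← word_nil, cf_word]
        simp
      cases W with
      | nil => simp [replaceSum]
      | cons s W => simp [replaceSum, h1, replaceSum_zero]
    | cons t l ih =>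
      rw [word_cons, dirDeriv_mul, dirDeriv_ι, map_add]
      cases W with
      | nil =>
        rw [cf_nil_ι_mul]
        split_ifs <;> simp [replaceSum, cf_nil_ι_mul]
      | cons s W =>
        rw [replaceSum, cf_cons_ι_mul, ih]
        congr 1
        · simp only [cf_cons_ι_mul]
          split_ifs <;> simp [replaceSum_zero]
        · simp only [cf_cons_ι_mul]
          split_ifs <;> simp_all [cf_cons_ι_mul]
  | hadd p q hp hq => simp [dirDeriv_add, hp, hq, replaceSum_add]
  | hsmul c p hp => simp [dirDeriv_smul, hp, replaceSum_smul]

theorem exists_of_replaceSum_ne_zero {g : ℕ} (i : Fin g) (W : List (Option (Fin g)))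
    (f : List (Option (Fin g)) → ℝ) (h : replaceSum i W f ≠ 0) :
    ∃ l, f l ≠ 0 ∧ l.length = W.length ∧ W.count none = l.count none + 1 := by
  induction W generalizing f with
  | nil => simp [replaceSum] at h
  | cons s W ih =>
    rw [replaceSum] at h
    by_cases h1 : replaceSum i W (fun l => f (s :: l)) = 0
    · rw [h1, zero_add, ite_ne_right_iff] at h
      obtain ⟨rfl, h⟩ := h
      exact ⟨_, h, by simp, by simp⟩
    · obtain ⟨l, hl, hl1, hl2⟩ := ih _ h1
      exact ⟨s :: l, hl, by simp [hl1], by simp only [List.count_cons, hl2]; omega⟩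

theorem replaceSum_map_some_append {g : ℕ} (i : Fin g) (u : List (Fin g))
    (W : List (Option (Fin g))) (f : List (Option (Fin g)) → ℝ) :
    replaceSum i (u.map some ++ W) f = replaceSum i W fun l => f (u.map some ++ l) := by
  induction u generalizing f with
  | nil => simp
  | cons s u ih => simp [replaceSum, ih]

theorem replaceSum_map_some {g : ℕ} (i : Fin g) (u : List (Fin g))
    (f : List (Option (Fin g)) → ℝ) : replaceSum i (u.map some) f = 0 := by
  by_contra h
  obtain ⟨l, -, -, h⟩ := exists_of_replaceSum_ne_zero _ _ _ h
  have : (u.map some).count (none : Option (Fin g)) = 0 := by simp [List.count_eq_zero]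
  omega

/-- The word `u h v h w`. -/
def hhWord {g : ℕ} (u v w : List (Fin g)) : List (Option (Fin g)) :=
  u.map some ++ none :: (v.map some ++ none :: w.map some)

theorem cf_inclX {g : ℕ} (l : List (Fin g)) (p : NCPoly (Fin g)) :
    cf (l.map some) (inclX p) = cf l p := by
  classical
  have hw : ∀ l : List (Fin g), inclX (word l) = word (l.map some) := by
    intro l
    simp [word, inclX, map_list_prod, Function.comp_def]
  induction p using induction_word with
  | hw l' =>
    rw [hw, cf_word, cf_word]
    congr 1
    simp [List.map_inj_right]
  | hadd p q hp hq => simp [hp, hq]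
  | hsmul c p hp => simp [hp]

theorem exists_eq_map_some {α : Type} (W : List (Option α)) (h : none ∉ W) :
    ∃ u : List α, W = u.map some := by
  induction W with
  | nil => exact ⟨[], rfl⟩
  | cons s W ih =>
    obtain ⟨u, rfl⟩ := ih (by simp_all)
    cases s with
    | none => simp at h
    | some s => exact ⟨s :: u, rfl⟩

theorem exists_eq_map_some_append {α : Type} (W : List (Option α)) (h : none ∈ W) :
    ∃ (u : List α) (W' : List (Option α)), W = u.map some ++ none :: W' := by
  induction W with
  | nil => simp at h
  | cons s W ih =>
    cases s with
    | none => exact ⟨[], W, rfl⟩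
    | some s =>
      obtain ⟨u, W', rfl⟩ := ih (by simpa using h)
      exact ⟨s :: u, W', rfl⟩

theorem exists_eq_hhWord {g : ℕ} (W : List (Option (Fin g))) (h : W.count none = 2) :
    ∃ u v w : List (Fin g), W = hhWord u v w := by
  have h0 : ∀ u : List (Fin g), (u.map some).count none = 0 := by simp [List.count_eq_zero]
  obtain ⟨u, W, rfl⟩ := exists_eq_map_some_append W (List.count_pos_iff.1 (by omega))
  rw [List.count_append, List.count_cons_self, h0] at h
  obtain ⟨v, W, rfl⟩ := exists_eq_map_some_append W (List.count_pos_iff.1 (by omega))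
  rw [List.count_append, List.count_cons_self, h0] at h
  obtain ⟨w, rfl⟩ := exists_eq_map_some W (List.count_eq_zero.1 (by omega))
  exact ⟨u, v, w, rfl⟩

theorem cf_inclX_eq_zero {g : ℕ} (W : List (Option (Fin g))) (h : none ∈ W)
    (p : NCPoly (Fin g)) : cf W (inclX p) = 0 := by
  classical
  induction p using induction_word with
  | hw l =>
    have : inclX (word l) = word (l.map some) := by
      simp [word, inclX, map_list_prod, Function.comp_def]
    rw [this, cf_word, if_neg]
    rintro rfl
    simp at h
  | hadd p q hp hq => simp [hp, hq]
  | hsmul c p hp => simp [hp]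

theorem cf_lap {g : ℕ} (W : List (Option (Fin g))) (p : NCPoly (Fin g)) :
    cf W (lap p) = ∑ i, replaceSum i W fun l => replaceSum i l fun l' => cf l' (inclX p) := by
  simp only [lap, map_sum, cf_dirDeriv]

/-- The factor 2 counts the orders in which the two letters `h` are turned back into `x_i`. -/
theorem cf_hhWord_lap {g : ℕ} (u v w : List (Fin g)) (p : NCPoly (Fin g)) :
    cf (hhWord u v w) (lap p) = 2 * ∑ i, cf (u ++ i :: (v ++ i :: w)) p := by
  rw [cf_lap, Finset.mul_sum]
  refine Finset.sum_congr rfl fun i _ => ?_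
  have e : ∀ i : Fin g, ∀ v W, some i :: (List.map some v ++ W) = List.map some (i :: v) ++ W := by
    simp
  simp only [hhWord, replaceSum_map_some_append, replaceSum, replaceSum_map_some, if_true]
  simp only [e]
  simp only [← List.map_cons, ← List.map_append, cf_inclX]
  simp [two_mul]

theorem exists_hhWord_of_cf_lap_ne_zero {g : ℕ} {W : List (Option (Fin g))} {p : NCPoly (Fin g)}
    (h : cf W (lap p) ≠ 0) : ∃ u v w, W = hhWord u v w := by
  rw [cf_lap] at h
  obtain ⟨i, -, h⟩ := Finset.exists_ne_zero_of_sum_ne_zero h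
  obtain ⟨l, hl, -, h1⟩ := exists_of_replaceSum_ne_zero _ _ _ h
  obtain ⟨l', hl', -, h2⟩ := exists_of_replaceSum_ne_zero _ _ _ hl
  have h3 : l'.count none = 0 := List.count_eq_zero.2 fun h => hl' (cf_inclX_eq_zero _ h p)
  exact exists_eq_hhWord W (by omega)

/-- A polynomial is harmonic if and only if all contractions of its coefficients vanish. -/
theorem isHarmonic_iff {g : ℕ} {p : NCPoly (Fin g)} :
    p.IsHarmonic ↔ ∀ u v w : List (Fin g), ∑ i, cf (u ++ i :: (v ++ i :: w)) p = 0 := by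
  constructor
  · intro h u v w
    have := cf_hhWord_lap u v w p
    rw [show lap p = 0 from h, map_zero] at this
    linarith
  · intro h
    refine ext_cf fun W => ?_
    rw [map_zero]
    by_contra hW
    obtain ⟨u, v, w, rfl⟩ := exists_hhWord_of_cf_lap_ne_zero hW
    exact hW (by rw [cf_hhWord_lap, h, mul_zero])

theorem isHomogeneous_lap {g d : ℕ} {p : NCPoly (Fin g)} (hp : p.IsHomogeneous d) :
    (lap p).IsHomogeneous d := by
  rw [isHomogeneous_iff]
  intro W hW
  obtain ⟨u, v, w, rfl⟩ := exists_hhWord_of_cf_lap_ne_zero hW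
  rw [cf_hhWord_lap] at hW
  obtain ⟨i, -, h⟩ := Finset.exists_ne_zero_of_sum_ne_zero (right_ne_zero_of_mul hW)
  rw [← hp _ h]
  simp [hhWord, FreeMonoid.length]

theorem none_mem_of_cf_lap_ne_zero {g : ℕ} {W : List (Option (Fin g))} {p : NCPoly (Fin g)}
    (h : cf W (lap p) ≠ 0) : none ∈ W := by
  obtain ⟨u, v, w, rfl⟩ := exists_hhWord_of_cf_lap_ne_zero h
  simp [hhWord]

/-! ### Path matrices and matrix positivity -/

open Classical in
/-- The adjacency matrices of the edges with a given letter in the path graph whose successive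
edges are labelled by the letters of `W`. -/
def pathMatrix {σ : Type} (W : List σ) (s : σ) :
    Matrix (Fin (W.length + 1)) (Fin (W.length + 1)) ℝ :=
  Matrix.of fun i j =>
    if (j.val = i.val + 1 ∧ W[i.val]? = some s) ∨ (i.val = j.val + 1 ∧ W[j.val]? = some s)
    then 1 else 0

theorem pathMatrix_isSymm {σ : Type} (W : List σ) (s : σ) : (pathMatrix W s).IsSymm := by
  ext i j
  simp only [pathMatrix, Matrix.transpose_apply, Matrix.of_apply]
  congr 1
  exact propext or_comm

theorem of_pathMatrix_ne_zero {σ : Type} {W : List σ} {s : σ} {i j : Fin (W.length + 1)}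
    (h : pathMatrix W s i j ≠ 0) :
    (j.val = i.val + 1 ∧ W[i.val]? = some s) ∨ (i.val = j.val + 1 ∧ W[j.val]? = some s) := by
  by_contra h'
  exact h (by simp only [pathMatrix, Matrix.of_apply, if_neg h'])

/-- The product of the path matrices along a word. -/
def pathProd {σ : Type} (W l : List σ) :
    Matrix (Fin (W.length + 1)) (Fin (W.length + 1)) ℝ :=
  FreeAlgebra.lift ℝ (pathMatrix W) (word l)

theorem pathProd_nil {σ : Type} (W : List σ) : pathProd W [] = 1 := by simp [pathProd]

theorem pathProd_cons {σ : Type} (W : List σ) (s : σ) (l : List σ) :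
    pathProd W (s :: l) = pathMatrix W s * pathProd W l := by simp [pathProd]

theorem exists_of_pathProd_cons_ne_zero {σ : Type} {W : List σ} {s : σ} {l : List σ}
    {i k : Fin (W.length + 1)} (h : pathProd W (s :: l) i k ≠ 0) :
    ∃ j, ((j.val = i.val + 1 ∧ W[i.val]? = some s) ∨
      (i.val = j.val + 1 ∧ W[j.val]? = some s)) ∧ pathProd W l j k ≠ 0 := by
  rw [pathProd_cons, Matrix.mul_apply] at h
  obtain ⟨j, -, hj⟩ := Finset.exists_ne_zero_of_sum_ne_zero h
  exact ⟨j, of_pathMatrix_ne_zero (left_ne_zero_of_mul hj), right_ne_zero_of_mul hj⟩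

/-- Each letter moves a walk by only one vertex. -/
theorem le_of_pathProd_ne_zero {σ : Type} {W l : List σ} {i : Fin (W.length + 1)}
    (h : pathProd W l i (Fin.last _) ≠ 0) : W.length ≤ l.length + i.val := by
  induction l generalizing i with
  | nil =>
    rw [pathProd_nil] at h
    have : i = Fin.last _ := by
      by_contra hi
      exact h (Matrix.one_apply_ne hi)
    simp [this]
  | cons s l ih =>
    obtain ⟨j, hj, h⟩ := exists_of_pathProd_cons_ne_zero h
    have := ih h
    rw [List.length_cons]
    omega

-- A walk with no step to spare must always move forward, so its labels are forced.
open Classical in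
theorem pathProd_eq_ite {σ : Type} {W l : List σ} {i : Fin (W.length + 1)}
    (h : l.length + i.val = W.length) :
    pathProd W l i (Fin.last _) = if l = W.drop i.val then 1 else 0 := by
  induction l generalizing i with
  | nil =>
    have : i = Fin.last _ := Fin.ext (by simpa using h)
    simp [pathProd_nil, this]
  | cons s l ih =>
    rw [List.length_cons] at h
    have hi : i.val < W.length := by omega
    rw [pathProd_cons, Matrix.mul_apply, Finset.sum_eq_single ⟨i.val + 1, by omega⟩]
    · rw [ih (by simp only; omega), List.drop_eq_getElem_cons hi]
      have h1 : ¬ i.val = i.val + 1 + 1 := by omega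
      simp only [pathMatrix, Matrix.of_apply, true_and, h1, false_and, or_false,
        List.getElem?_eq_getElem hi, Option.some_inj, List.cons.injEq, eq_comm (a := s)]
      by_cases h2 : W[i.val] = s <;> simp [h2]
    · intro j _ hj
      by_contra hne
      have h1 := of_pathMatrix_ne_zero (left_ne_zero_of_mul hne)
      have h2 := le_of_pathProd_ne_zero (right_ne_zero_of_mul hne)
      have h3 : j.val ≠ i.val + 1 := fun h => hj (Fin.ext h)
      omega
    · simp

/-- A walk that ends at the end of the path and uses an edge with a label that does not occur
from position `r` on is long. -/
theorem le_of_pathProd_ne_zero_of_mem {σ : Type} {W l : List σ} {r : ℕ} {s₀ : σ}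
    (hW : ∀ k, r ≤ k → W[k]? ≠ some s₀) (hl : s₀ ∈ l) {i : Fin (W.length + 1)}
    (hi : r ≤ i.val) (h : pathProd W l i (Fin.last _) ≠ 0) :
    i.val + W.length + 2 ≤ l.length + 2 * r := by
  induction l generalizing i with
  | nil => simp at hl
  | cons s l ih =>
    obtain ⟨j, hj, h⟩ := exists_of_pathProd_cons_ne_zero h
    have h1 := le_of_pathProd_ne_zero h
    rw [List.length_cons]
    -- If the step stays at or beyond `r`, its edge does not carry `s₀`, and the tail of the walk
    -- still has to use that label. Otherwise the walk has just gone from `r` to `r - 1`, and the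
    -- distance back to the end gives the bound.
    by_cases hjr : r ≤ j.val
    · have hs : s₀ ≠ s := by
        rintro rfl
        rcases hj with hj | hj
        · exact hW _ hi hj.2
        · exact hW _ hjr hj.2
      have := ih (by simpa [hs] using hl) hjr h
      omega
    · omega

theorem lift_pathMatrix_apply {σ : Type} (W : List σ) (q : NCPoly σ) (i j) :
    ∃ S : Finset (List σ), FreeAlgebra.lift ℝ (pathMatrix W) q i j =
      ∑ l ∈ S, cf l q * pathProd W l i j ∧ ∀ l, l ∈ S ↔ cf l q ≠ 0 := by
  obtain ⟨S, hS, hS0⟩ := exists_sum_word q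
  refine ⟨S, ?_, fun l => ⟨hS0 l, fun h => ?_⟩⟩
  · conv_lhs => rw [hS]
    rw [map_sum, Matrix.sum_apply]
    refine Finset.sum_congr rfl fun l _ => ?_
    rw [map_smul, Matrix.smul_apply, pathProd, smul_eq_mul]
  · classical
    by_contra hl
    apply h
    rw [hS, map_sum]
    refine Finset.sum_eq_zero fun l' hl' => ?_
    have : l ≠ l' := fun e => hl (e ▸ hl')
    simp [cf_word, this]

/-- The principal 2 × 2 minor on `i`, `j` equals `-(A i j) ^ 2`. -/
theorem _root_.Matrix.PosSemidef.apply_eq_zero_of_diag_eq_zero {n : Type*} {A : Matrix n n ℝ}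
    (hA : A.PosSemidef) {j : n} (hj : A j j = 0) (i : n) : A i j = 0 := by
  have h := (hA.submatrix ![i, j]).det_nonneg
  have hs : A j i = A i j := by simpa using hA.isHermitian.apply i j
  simp only [Matrix.det_fin_two, Matrix.submatrix_apply, Matrix.cons_val_zero,
    Matrix.cons_val_one, hj, hs] at h
  nlinarith [sq_nonneg (A i j)]

/-- In a matrix positive homogeneous polynomial of which all monomials contain `s₀`, no monomial
ends with a string of length at least half the degree that does not contain `s₀`. -/
theorem IsMatrixPositive.cf_eq_zero {σ : Type} {q : NCPoly σ} {d r : ℕ} {s₀ : σ}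
    (hq : q.IsMatrixPositive) (hd : q.IsHomogeneous d) (hmem : ∀ l, cf l q ≠ 0 → s₀ ∈ l)
    {W : List σ} (hWd : W.length = d) (hr : 2 * r ≤ d) (hW : ∀ k, r ≤ k → W[k]? ≠ some s₀) :
    cf W q = 0 := by
  classical
  subst hWd
  have hpos := hq.2 _ (pathMatrix W) (pathMatrix_isSymm W)
  -- A closed walk from the far end through an `s₀` edge would have length at least `2 * (d - r) +
  -- 2`, which exceeds `d`.
  have hdiag : FreeAlgebra.lift ℝ (pathMatrix W) q (Fin.last _) (Fin.last _) = 0 := by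
    obtain ⟨S, hS, hS0⟩ := lift_pathMatrix_apply W q (Fin.last _) (Fin.last _)
    rw [hS]
    refine Finset.sum_eq_zero fun l hl => ?_
    by_contra hne
    have h1 := le_of_pathProd_ne_zero_of_mem hW (hmem l ((hS0 l).1 hl))
      (by rw [Fin.val_last]; omega) (right_ne_zero_of_mul hne)
    have h2 : l.length = W.length := hd l ((hS0 l).1 hl)
    rw [Fin.val_last] at h1
    omega
  have h0 := hpos.apply_eq_zero_of_diag_eq_zero hdiag 0
  -- Among words of length `d`, only `W` itself labels a walk from one end to the other.
  obtain ⟨S, hS, hS0⟩ := lift_pathMatrix_apply W q 0 (Fin.last _)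
  have h1 : ∑ l ∈ S, cf l q * pathProd W l 0 (Fin.last _) =
      ∑ l ∈ S, cf l q * if l = W then 1 else 0 := by
    refine Finset.sum_congr rfl fun l hl => ?_
    rw [pathProd_eq_ite (show l.length + 0 = W.length from hd l ((hS0 l).1 hl))]
    simp
  rw [hS, h1] at h0
  by_contra hne
  simp only [mul_ite, mul_one, mul_zero, Finset.sum_ite_eq', (hS0 W).2 hne, if_true] at h0
  exact hne h0

theorem sum_cf_eq_zero_of_isSubharmonic {g d : ℕ} {p : NCPoly (Fin g)} (hp : p.IsHomogeneous d)
    (hs : p.IsSubharmonic) (u v w : List (Fin g)) (h : d ≤ 2 * w.length ∨ d ≤ 2 * u.length) :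
    ∑ i, cf (u ++ i :: (v ++ i :: w)) p = 0 := by
  have key : ∀ u v w : List (Fin g), d ≤ 2 * w.length → cf (hhWord u v w) (lap p) = 0 := by
    intro u v w h
    by_cases hl : (hhWord u v w).length = d
    · have hlen : d = u.length + v.length + w.length + 2 := by
        rw [← hl]; simp [hhWord]; omega
      -- The tail `w` starts at position `d - w.length`, and both letters `h` lie before it.
      refine hs.cf_eq_zero (isHomogeneous_lap hp) (fun l hl => none_mem_of_cf_lap_ne_zero hl) hl
        (r := d - w.length) (by omega) fun k hk => ?_
      rw [hhWord, List.getElem?_append_right (by simp; omega), List.getElem?_cons,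
        if_neg (by simp; omega), List.getElem?_append_right (by simp; omega),
        List.getElem?_cons, if_neg (by simp; omega)]
      simp
    · exact eq_zero_of_isHomogeneous (isHomogeneous_lap hp) hl
  have h2 : cf (hhWord u v w) (lap p) = 0 := by
    rcases h with h | h
    · exact key u v w h
    -- The Laplacian is symmetric, so reversing words exchanges the two halves.
    · have e : star (lap p) = lap p := hs.1
      rw [← e, cf_star]
      convert key w.reverse v.reverse u.reverse (by simpa using h) using 2
      simp [hhWord]
  rw [cf_hhWord_lap] at h2
  linarith

/-! ### Harmonic polynomials and interpolation -/

theorem mem_harmonics_iff {g m : ℕ} {p : NCPoly (Fin g)} :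
    p ∈ harmonics g m ↔ p.IsHomogeneous m ∧
      ∀ u v w : List (Fin g), ∑ i, cf (u ++ i :: (v ++ i :: w)) p = 0 := by
  rw [← isHarmonic_iff]
  rfl

theorem star_mem_harmonics {g m : ℕ} {p : NCPoly (Fin g)} (hp : p ∈ harmonics g m) :
    star p ∈ harmonics g m := by
  rw [mem_harmonics_iff] at hp ⊢
  refine ⟨isHomogeneous_star hp.1, fun u v w => ?_⟩
  simpa [cf_star] using hp.2 w.reverse v.reverse u.reverse

/-- The homogeneous polynomial of degree `m` with coefficients given by `f`. -/
def ofFun {g : ℕ} (m : ℕ) (f : List (Fin g) → ℝ) : NCPoly (Fin g) :=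
  ∑ l ∈ (List.finite_length_eq (Fin g) m).toFinset, f l • word l

theorem cf_ofFun {g : ℕ} (m : ℕ) (f : List (Fin g) → ℝ) (l : List (Fin g)) :
    cf l (ofFun m f) = if l.length = m then f l else 0 := by
  classical
  simp [ofFun, cf_word]

theorem isHomogeneous_ofFun {g : ℕ} (m : ℕ) (f : List (Fin g) → ℝ) :
    (ofFun m f).IsHomogeneous m := by
  rw [isHomogeneous_iff]
  intro l hl
  rw [cf_ofFun] at hl
  by_contra h
  exact hl (if_neg h)

theorem ofFun_mem_harmonics {g m : ℕ} {f : List (Fin g) → ℝ}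
    (hf : ∀ u v w : List (Fin g), u.length + v.length + w.length + 2 = m →
      ∑ i, f (u ++ i :: (v ++ i :: w)) = 0) : ofFun m f ∈ harmonics g m := by
  rw [mem_harmonics_iff]
  refine ⟨isHomogeneous_ofFun m f, fun u v w => ?_⟩
  have e : ∀ i : Fin g, (u ++ i :: (v ++ i :: w)).length = u.length + v.length + w.length + 2 := by
    intro i
    simp only [List.length_append, List.length_cons]
    omega
  simp only [cf_ofFun, e]
  split_ifs with h
  · exact hf u v w h
  · simp

/-- The elements of `H` are determined by their coefficients at the words `w j`, by
interpolation with the family `γ`. -/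
def Interpolates {g k : ℕ} (γ : Fin k → NCPoly (Fin g)) (w : Fin k → List (Fin g))
    (H : Submodule ℝ (NCPoly (Fin g))) : Prop :=
  ∀ f ∈ H, ∀ u, cf u f = ∑ j, cf (w j) f / cf (w j) (γ j) * cf u (γ j)

/-- Evaluating a combination of the `γ i` at the private word `w j` isolates its `j`-th coefficient.
-/
theorem interpolates_of_span {g k : ℕ} {γ : Fin k → NCPoly (Fin g)} {w : Fin k → List (Fin g)}
    (hw : ∀ j, cf (w j) (γ j) ≠ 0) (hne : ∀ j i, i ≠ j → cf (w j) (γ i) = 0) :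
    Interpolates γ w (Submodule.span ℝ (Set.range γ)) := by
  intro f hf u
  obtain ⟨c, rfl⟩ := (Submodule.mem_span_range_iff_exists_fun ℝ).1 hf
  have h1 : ∀ j, cf (w j) (∑ i, c i • γ i) = c j * cf (w j) (γ j) := by
    intro j
    rw [map_sum, Finset.sum_eq_single j]
    · simp
    · intro i _ hi
      simp [hne j i hi]
    · simp
  simp only [h1, mul_div_cancel_right₀ _ (hw _)]
  simp

theorem Interpolates.star {g k m : ℕ} {γ : Fin k → NCPoly (Fin g)} {w : Fin k → List (Fin g)}
    (h : Interpolates γ w (harmonics g m)) :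
    Interpolates (fun j => star (γ j)) (fun j => (w j).reverse) (harmonics g m) := by
  intro f hf u
  have h1 := h _ (star_mem_harmonics hf) u.reverse
  simpa [cf_star] using h1

/-- A polynomial of degree `2 * m` whose coefficients have vanishing contractions within each
half of a word is a combination of products of harmonic polynomials. -/
theorem eq_sum_of_contractions_eq_zero {g k m : ℕ} {γ δ : Fin k → NCPoly (Fin g)}
    {w w' : Fin k → List (Fin g)} (hδm : ∀ i, (δ i).IsHomogeneous m)
    (hγm : ∀ i, (γ i).IsHomogeneous m)
    (hγ : Interpolates γ w (harmonics g m)) (hδ : Interpolates δ w' (harmonics g m))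
    (hw : ∀ j, (w j).length = m) (hw' : ∀ j, (w' j).length = m)
    {p : NCPoly (Fin g)} (hp : p.IsHomogeneous (2 * m))
    (hc : ∀ u v w : List (Fin g), 2 * m ≤ 2 * w.length ∨ 2 * m ≤ 2 * u.length →
      ∑ i, cf (u ++ i :: (v ++ i :: w)) p = 0) :
    p = ∑ i, ∑ j, (cf (w' i ++ w j) p / (cf (w' i) (δ i) * cf (w j) (γ j))) • (δ i * γ j) := by
  have hleft : ∀ v u : List (Fin g), v.length = m → u.length = m →
      cf (u ++ v) p = ∑ i, cf (w' i ++ v) p / cf (w' i) (δ i) * cf u (δ i) := by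
    intro v u hv hu
    -- With the right half `v` fixed, every contraction in `u` is a contraction of `p` followed by a
    -- tail of length at least `m`, so it vanishes.
    have hmem : ofFun m (fun u => cf (u ++ v) p) ∈ harmonics g m :=
      ofFun_mem_harmonics fun x y z _ => by
        simpa using hc x y (z ++ v) (Or.inl (by simp [hv]))
    simpa [cf_ofFun, hu, hw'] using hδ _ hmem u
  have hright : ∀ u v : List (Fin g), u.length = m → v.length = m →
      cf (u ++ v) p = ∑ j, cf (u ++ w j) p / cf (w j) (γ j) * cf v (γ j) := by
    intro u v hu hv
    have hmem : ofFun m (fun v => cf (u ++ v) p) ∈ harmonics g m :=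
      ofFun_mem_harmonics fun x y z _ => by
        simpa using hc (u ++ x) y z (Or.inr (by simp [hu]))
    simpa [cf_ofFun, hv, hw] using hγ _ hmem v
  have hsum : (∑ i, ∑ j, (cf (w' i ++ w j) p / (cf (w' i) (δ i) * cf (w j) (γ j))) •
      (δ i * γ j)).IsHomogeneous (2 * m) :=
    isHomogeneous_sum _ fun i _ => isHomogeneous_sum _ fun j _ => isHomogeneous_smul
      (two_mul m ▸ isHomogeneous_mul (hδm i) (hγm j)) _
  refine ext_cf fun l => ?_
  by_cases hl : l.length = 2 * m
  · obtain ⟨u, v, rfl, hu⟩ : ∃ u v, l = u ++ v ∧ u.length = m :=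
      ⟨l.take m, l.drop m, (List.take_append_drop m l).symm, by simp; omega⟩
    have hv : v.length = m := by rw [List.length_append] at hl; omega
    rw [hleft v u hv hu]
    simp only [map_sum, map_smul, smul_eq_mul, cf_append_mul (hδm _) _ hu]
    refine Finset.sum_congr rfl fun i _ => ?_
    -- The left half is now the interpolation word `w' i`; interpolating the right half leaves only
    -- the values of `p` at `w' i ++ w j`.
    rw [hright (w' i) v (hw' i) hv, Finset.sum_div, Finset.sum_mul]
    refine Finset.sum_congr rfl fun j _ => ?_
    ring
  · rw [eq_zero_of_isHomogeneous hp hl, eq_zero_of_isHomogeneous hsum hl]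

/-- The left factors `star (γ i)` are interpolated at the reversed private words. Reversing the word
`(w i).reverse ++ w j` swaps `i` and `j`, so the coefficient matrix inherits the symmetry of `p`. -/
theorem exists_isSymm_of_isSubharmonic {g k m : ℕ} {γ : Fin k → NCPoly (Fin g)}
    {w : Fin k → List (Fin g)} (hγm : ∀ i, (γ i).IsHomogeneous m)
    (hγ : Interpolates γ w (harmonics g m)) (hw : ∀ j, (w j).length = m)
    {p : NCPoly (Fin g)} (hp : p.IsHomogeneous (2 * m)) (hs : p.IsSubharmonic)
    (hsymm : p.IsSymmetric) :
    ∃ φ : Matrix (Fin k) (Fin k) ℝ, φ.IsSymm ∧ p = ∑ i, ∑ j, φ i j • (star (γ i) * γ j) := by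
  have h := eq_sum_of_contractions_eq_zero (δ := fun i => star (γ i))
    (fun i => isHomogeneous_star (hγm i)) hγm hγ hγ.star hw (by simpa using hw) hp
    (sum_cf_eq_zero_of_isSubharmonic hp hs)
  refine ⟨Matrix.of fun i j => _, ?_, h⟩
  ext i j
  have e : cf ((w j).reverse ++ w i) p = cf ((w i).reverse ++ w j) p := by
    conv_lhs => rw [← show star p = p from hsymm, cf_star]
    simp
  simp only [Matrix.transpose_apply, Matrix.of_apply, e, cf_star, List.reverse_reverse]
  rw [mul_comm (cf (w j) (γ j))]

/-! ### The dimension bound -/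

/-- The symmetrized products spanning the combinations with symmetric coefficients. -/
def symProd {g k : ℕ} (γ : Fin k → NCPoly (Fin g)) : Sym2 (Fin k) → NCPoly (Fin g) :=
  Sym2.lift ⟨fun i j => star (γ i) * γ j + star (γ j) * γ i, fun _ _ => add_comm _ _⟩

theorem sum_mem_span_symProd {g k : ℕ} (γ : Fin k → NCPoly (Fin g))
    {φ : Matrix (Fin k) (Fin k) ℝ} (hφ : φ.IsSymm) :
    ∑ i, ∑ j, φ i j • (star (γ i) * γ j) ∈ Submodule.span ℝ (Set.range (symProd γ)) := by
  have h : ∑ i, ∑ j, φ i j • (star (γ i) * γ j) =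
      ∑ i, ∑ j, (φ i j / 2) • symProd γ s(i, j) := by
    have h1 : ∑ i, ∑ j, (φ i j / 2) • (star (γ j) * γ i) =
        ∑ i, ∑ j, (φ i j / 2) • (star (γ i) * γ j) := by
      rw [Finset.sum_comm]
      simp only [hφ.apply]
    simp only [symProd, Sym2.lift_mk, smul_add, Finset.sum_add_distrib, h1]
    simp only [← Finset.sum_add_distrib, ← add_smul, add_halves]
  rw [h]
  exact Submodule.sum_mem _ fun i _ => Submodule.sum_mem _ fun j _ =>
    Submodule.smul_mem _ _ (Submodule.subset_span ⟨_, rfl⟩)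

/-- The symmetrized products are indexed by unordered pairs, of which there are `k * (k + 1) / 2`
with repetition allowed. -/
theorem finrank_symmSubharmonicSpan_le {g k m : ℕ} {γ : Fin k → NCPoly (Fin g)}
    {w : Fin k → List (Fin g)} (hγm : ∀ i, (γ i).IsHomogeneous m)
    (hγ : Interpolates γ w (harmonics g m)) (hw : ∀ j, (w j).length = m) :
    Module.Finite ℝ (symmSubharmonicSpan g (2 * m)) ∧
      Module.finrank ℝ (symmSubharmonicSpan g (2 * m)) ≤ k * (k + 1) / 2 := by
  have hle : symmSubharmonicSpan g (2 * m) ≤ Submodule.span ℝ (Set.range (symProd γ)) := by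
    refine Submodule.span_le.2 ?_
    rintro p ⟨hp, hsymm, hs⟩
    obtain ⟨φ, hφ, rfl⟩ := exists_isSymm_of_isSubharmonic hγm hγ hw hp hs hsymm
    exact sum_mem_span_symProd γ hφ
  have hfin : Module.Finite ℝ (Submodule.span ℝ (Set.range (symProd γ))) :=
    FiniteDimensional.span_of_finite ℝ (Set.finite_range _)
  refine ⟨Submodule.finiteDimensional_of_le hle, (Submodule.finrank_mono hle).trans ?_⟩
  refine (finrank_range_le_card (R := ℝ) (symProd γ)).trans (le_of_eq ?_)
  rw [Sym2.card, Fintype.card_fin, Nat.choose_two_right, Nat.add_sub_cancel, mul_comm]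

/-- Spanning families with private monomials interpolate. -/
theorem exists_interpolates {g k m : ℕ} {γ : Fin k → NCPoly (Fin g)}
    (hspan : Submodule.span ℝ (Set.range γ) = harmonics g m) (hpriv : HasPrivateMonomials γ) :
    (∀ i, (γ i).IsHomogeneous m) ∧ ∃ w : Fin k → List (Fin g), (∀ j, (w j).length = m) ∧
      Interpolates γ w (harmonics g m) := by
  have hγm : ∀ i, (γ i).IsHomogeneous m := fun i =>
    (mem_harmonics_iff.1 (hspan ▸ Submodule.subset_span ⟨i, rfl⟩)).1
  choose w hw hne using hpriv
  exact ⟨hγm, w, fun j => hγm j _ (hw j), hspan ▸ interpolates_of_span hw hne⟩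

open Classical in
/-- A family in `H` that is dual to the coefficients at the words `w j`, on which these
coefficients are jointly injective, is a basis of `H`. -/
theorem span_eq_and_finrank_eq {g k : ℕ} {H : Submodule ℝ (NCPoly (Fin g))}
    {γ : Fin k → NCPoly (Fin g)} {w : Fin k → List (Fin g)} (hγ : ∀ i, γ i ∈ H)
    (hdual : ∀ j i, cf (w j) (γ i) = if i = j then 1 else 0)
    (hinj : ∀ f ∈ H, (∀ j, cf (w j) f = 0) → f = 0) :
    Submodule.span ℝ (Set.range γ) = H ∧ HasPrivateMonomials γ ∧ Module.finrank ℝ H = k := by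
  have hspan : Submodule.span ℝ (Set.range γ) = H := by
    refine le_antisymm (Submodule.span_le.2 (by rintro _ ⟨i, rfl⟩; exact hγ i)) fun f hf => ?_
    have h : f - ∑ i, cf (w i) f • γ i = 0 := by
      refine hinj _ (H.sub_mem hf (H.sum_mem fun i _ => H.smul_mem _ (hγ i))) fun j => ?_
      simp [hdual]
    rw [sub_eq_zero.1 h]
    exact Submodule.sum_mem _ fun i _ => Submodule.smul_mem _ _ (Submodule.subset_span ⟨i, rfl⟩)
  refine ⟨hspan, fun j => ⟨FreeMonoid.ofList (w j), ?_, fun i hi => ?_⟩, ?_⟩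
  · change cf (w j) (γ j) ≠ 0
    simp [hdual]
  · change cf (w j) (γ i) = 0
    simp [hdual, hi]
  · have hli : LinearIndependent ℝ γ := by
      rw [Fintype.linearIndependent_iff]
      intro c hc j
      simpa [hdual] using congrArg (cf (w j)) hc
    rw [← hspan, finrank_span_eq_card hli, Fintype.card_fin]

/-! ### Two variables -/

theorem contraction_two {m : ℕ} {f : NCPoly (Fin 2)} (hf : f ∈ harmonics 2 m)
    (u v w : List (Fin 2)) :
    cf (u ++ 1 :: (v ++ 1 :: w)) f = -cf (u ++ 0 :: (v ++ 0 :: w)) f := by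
  have := (mem_harmonics_iff.1 hf).2 u v w
  rw [Fin.sum_univ_two] at this
  linarith

theorem eq_replicate_zero {u : List (Fin 2)} (h : u.count 1 = 0) :
    u = List.replicate u.length 0 := by
  rw [List.eq_replicate_iff]
  refine ⟨rfl, fun b hb => ?_⟩
  have : b ≠ 1 := fun e => List.count_eq_zero.1 h (e ▸ hb)
  omega

/-- Contractions remove letters `1` in pairs, down to words with at most one. For `m ≥ 3` the
position of a lone `1` is immaterial, since contracting a word with three letters `1` in two ways
identifies two positions; in degree 2 there is no room for this, hence the extra condition `h2`. -/
theorem eq_zero_of_mem_harmonics_two {m : ℕ} {f : NCPoly (Fin 2)} (hf : f ∈ harmonics 2 m)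
    (h0 : cf (List.replicate m 0) f = 0) (h1 : cf (1 :: List.replicate (m - 1) 0) f = 0)
    (h2 : m = 2 → cf [0, 1] f = 0) : f = 0 := by
  have hm := (mem_harmonics_iff.1 hf).1
  have key : ∀ n, ∀ u : List (Fin 2), u.length = m → u.count 1 = n → cf u f = 0 := by
    intro n
    induction n using Nat.strong_induction_on with
    | _ n ih =>
      intro u hu hn
      rcases Nat.lt_or_ge 0 n with hpos | hpos
      · obtain ⟨x, y, rfl⟩ := List.append_of_mem (List.count_pos_iff.1 (hn ▸ hpos))
        rw [List.count_append, List.count_cons_self] at hn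
        rw [List.length_append, List.length_cons] at hu
        rcases Nat.lt_or_ge 0 (y.count 1) with hy | hy
        · obtain ⟨y, z, rfl⟩ := List.append_of_mem (List.count_pos_iff.1 hy)
          rw [List.count_append, List.count_cons_self] at hn
          rw [contraction_two hf, neg_eq_zero]
          refine ih (n - 2) (by omega) _ ?_ ?_
          · simp at hu ⊢; omega
          · simp; omega
        rcases Nat.lt_or_ge 0 (x.count 1) with hx | hx
        · obtain ⟨x, x', rfl⟩ := List.append_of_mem (List.count_pos_iff.1 hx)
          rw [List.count_append, List.count_cons_self] at hn
          have e : (x ++ 1 :: x') ++ 1 :: y = x ++ 1 :: (x' ++ 1 :: y) := by simp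
          rw [e, contraction_two hf, neg_eq_zero]
          refine ih (n - 2) (by omega) _ ?_ ?_
          · simp at hu ⊢; omega
          · simp; omega
        have hx' := eq_replicate_zero (Nat.le_zero.1 hx)
        have hy' := eq_replicate_zero (Nat.le_zero.1 hy)
        have hall : ∀ l : List (Fin 2), l.length = m - 1 → l.count 1 = 0 →
            cf (1 :: l) f = 0 := by
          intro l hl hc
          rwa [eq_replicate_zero hc, hl]
        -- A single `1` remains, between blocks `x` and `y` of zeros; it is to be moved to the
        -- front.
        match x, hx' with
        | [], _ => exact hall y (by simp at hu; omega) (by omega)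
        | [a], hx' =>
          obtain rfl : a = 0 := by simpa using hx'
          match y, hy' with
          | [], _ => exact h2 (by simpa using hu.symm)
          | b :: y, hy' =>
            obtain rfl : b = 0 := by
              rw [List.length_cons, List.replicate_succ] at hy'
              exact (List.cons.inj hy').1
            -- Contracting `111y` in two ways gives equal coefficients at `010y` and `100y`.
            have e1 := contraction_two hf [] [1] y
            have e2 := contraction_two hf [1] [] y
            simp only [List.nil_append, List.cons_append] at e1 e2 ⊢
            have e3 := hall (0 :: 0 :: y) (by simp at hu ⊢; omega) (by simpa using hy)
            linarith
        | a :: b :: x, hx' =>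
          rw [List.length_cons, List.length_cons, List.replicate_succ, List.replicate_succ] at hx'
          obtain rfl : a = 0 := (List.cons.inj hx').1
          obtain rfl : b = 0 := (List.cons.inj (List.cons.inj hx').2).1
          -- Contracting `11x1y` in two ways gives equal coefficients at `00x1y` and `10x0y`.
          have e1 := contraction_two hf [] [] (x ++ 1 :: y)
          have e2 := contraction_two hf [1] x y
          simp only [List.nil_append, List.cons_append] at e1 e2 ⊢
          have e3 := hall (0 :: (x ++ 0 :: y)) (by simp at hu ⊢; omega)
            (by simp at hx hy ⊢; exact ⟨hx, hy⟩)
          linarith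
      · have := eq_replicate_zero (hn.trans (Nat.le_zero.1 hpos))
        rwa [this, hu]
  refine ext_cf fun u => ?_
  rw [map_zero]
  by_cases hu : u.length = m
  · exact key _ u hu rfl
  · exact eq_zero_of_isHomogeneous hm hu

/-- The real part of `(x_0 + i x_1) ^ m`. -/
def reHarmonic (m : ℕ) : NCPoly (Fin 2) := ofFun m fun l => (Complex.I ^ l.count 1).re

/-- The imaginary part of `(x_0 + i x_1) ^ m`. -/
def imHarmonic (m : ℕ) : NCPoly (Fin 2) := ofFun m fun l => (Complex.I ^ l.count 1).im

theorem I_pow_count_add (u v w : List (Fin 2)) :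
    Complex.I ^ (u ++ 0 :: (v ++ 0 :: w)).count 1 +
      Complex.I ^ (u ++ 1 :: (v ++ 1 :: w)).count 1 = 0 := by
  have e : (u ++ 1 :: (v ++ 1 :: w)).count 1 = (u ++ 0 :: (v ++ 0 :: w)).count 1 + 2 := by
    simp; omega
  rw [e, pow_add, Complex.I_sq]
  ring

theorem reHarmonic_mem (m : ℕ) : reHarmonic m ∈ harmonics 2 m :=
  ofFun_mem_harmonics fun u v w _ => by
    rw [Fin.sum_univ_two, ← Complex.add_re, I_pow_count_add, Complex.zero_re]

theorem imHarmonic_mem (m : ℕ) : imHarmonic m ∈ harmonics 2 m :=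
  ofFun_mem_harmonics fun u v w _ => by
    rw [Fin.sum_univ_two, ← Complex.add_im, I_pow_count_add, Complex.zero_im]

theorem harmonics_two_basis {m : ℕ} (hm : 1 ≤ m) (hm2 : m ≠ 2) :
    ∃ γ : Fin 2 → NCPoly (Fin 2), Submodule.span ℝ (Set.range γ) = harmonics 2 m ∧
      HasPrivateMonomials γ ∧ Module.finrank ℝ (harmonics 2 m) = 2 := by
  refine ⟨![reHarmonic m, imHarmonic m], span_eq_and_finrank_eq
    (w := ![List.replicate m 0, 1 :: List.replicate (m - 1) 0]) ?_ ?_ ?_⟩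
  · exact Fin.forall_fin_two.2 ⟨reHarmonic_mem m, imHarmonic_mem m⟩
  · have e : m - 1 + 1 = m := by omega
    simp [Fin.forall_fin_two, reHarmonic, imHarmonic, cf_ofFun, List.count_replicate, e]
  · intro f hf h
    exact eq_zero_of_mem_harmonics_two hf (h 0) (h 1) fun e => absurd e hm2

/-- In degree 2 the only contraction relates `x_0 x_0` and `x_1 x_1`, so `x_0 x_1` and `x_1 x_0` are
independently harmonic. -/
theorem harmonics_two_two_basis :
    ∃ γ : Fin 3 → NCPoly (Fin 2), Submodule.span ℝ (Set.range γ) = harmonics 2 2 ∧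
      HasPrivateMonomials γ := by
  have hmem : ∀ a b : Fin 2, a ≠ b →
      ofFun 2 (fun l => if l = [a, b] then 1 else 0) ∈ harmonics 2 2 := by
    intro a b hab
    refine ofFun_mem_harmonics fun u v w h => ?_
    obtain rfl : u = [] := List.length_eq_zero_iff.1 (by omega)
    obtain rfl : v = [] := List.length_eq_zero_iff.1 (by omega)
    obtain rfl : w = [] := List.length_eq_zero_iff.1 (by omega)
    refine Finset.sum_eq_zero fun i _ => if_neg ?_
    simp only [List.nil_append, List.cons.injEq, and_true]
    rintro ⟨rfl, h⟩
    exact hab h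
  have h := span_eq_and_finrank_eq (H := harmonics 2 2)
    (γ := ![reHarmonic 2, ofFun 2 (fun l => if l = [1, 0] then 1 else 0),
      ofFun 2 (fun l => if l = [0, 1] then 1 else 0)])
    (w := ![[0, 0], [1, 0], [0, 1]]) ?_ ?_ ?_
  · exact ⟨_, h.1, h.2.1⟩
  · simp only [Fin.forall_fin_succ, IsEmpty.forall_iff, and_true]
    exact ⟨reHarmonic_mem 2, hmem 1 0 (by decide), hmem 0 1 (by decide)⟩
  · simp [Fin.forall_fin_succ, reHarmonic, cf_ofFun]
  · intro f hf h
    exact eq_zero_of_mem_harmonics_two hf (h 0) (h 1) fun _ => h 2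

theorem harmonics_two_zero_basis :
    ∃ γ : Fin 1 → NCPoly (Fin 2), Submodule.span ℝ (Set.range γ) = harmonics 2 0 ∧
      HasPrivateMonomials γ := by
  have h := span_eq_and_finrank_eq (H := harmonics 2 0)
    (γ := ![reHarmonic 0]) (w := ![[]]) ?_ ?_ ?_
  · exact ⟨_, h.1, h.2.1⟩
  · simpa using reHarmonic_mem 0
  · simp [reHarmonic, cf_ofFun]
  · intro f hf h
    exact eq_zero_of_mem_harmonics_two hf (h 0)
      -- By truncated subtraction the second test word is `[1]`, whose length is not 0.
      (eq_zero_of_isHomogeneous (mem_harmonics_iff.1 hf).1 (by simp)) (by omega)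

end NCPoly

end

theorem proposition4p2 :
    (∀ (g d k : ℕ) (γ : Fin k → NCPoly (Fin g)), Even d →
      Submodule.span ℝ (Set.range γ) = NCPoly.harmonics g (d / 2) →
      NCPoly.HasPrivateMonomials γ →
      -- every homogeneous subharmonic of degree `d` is a combination of the products `γ i * γ j`
      (∀ p : NCPoly (Fin g), p.IsHomogeneous d → p.IsSubharmonic →
        ∃ φ : Matrix (Fin k) (Fin k) ℝ, p = ∑ i, ∑ j, φ i j • (γ i * γ j)) ∧
      -- symmetric `p`: a symmetric coefficient matrix, with transposed left factors
      (∀ p : NCPoly (Fin g), p.IsHomogeneous d → p.IsSubharmonic → p.IsSymmetric →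
        ∃ φ : Matrix (Fin k) (Fin k) ℝ, φ.IsSymm ∧
          p = ∑ i, ∑ j, φ i j • (star (γ i) * γ j)) ∧
      -- when the `γ i` are symmetric no transposes are needed
      ((∀ i, (γ i).IsSymmetric) →
        ∀ p : NCPoly (Fin g), p.IsHomogeneous d → p.IsSubharmonic → p.IsSymmetric →
          ∃ φ : Matrix (Fin k) (Fin k) ℝ, φ.IsSymm ∧ p = ∑ i, ∑ j, φ i j • (γ i * γ j)) ∧
      (Module.Finite ℝ (NCPoly.symmSubharmonicSpan g d) ∧
        Module.finrank ℝ (NCPoly.symmSubharmonicSpan g d) ≤ k * (k + 1) / 2)) ∧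
    -- two variables
    (∀ m : ℕ, 1 ≤ m → m ≠ 2 → Module.finrank ℝ (NCPoly.harmonics 2 m) = 2) ∧
    (∀ d : ℕ, Even d →
      Module.Finite ℝ (NCPoly.symmSubharmonicSpan 2 d) ∧
      (d ≠ 4 → Module.finrank ℝ (NCPoly.symmSubharmonicSpan 2 d) ≤ 3) ∧
      (d = 4 → Module.finrank ℝ (NCPoly.symmSubharmonicSpan 2 d) ≤ 6)) := by
  have main : ∀ {g k m : ℕ} {γ : Fin k → NCPoly (Fin g)},
      Submodule.span ℝ (Set.range γ) = NCPoly.harmonics g m → NCPoly.HasPrivateMonomials γ →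
      Module.Finite ℝ (NCPoly.symmSubharmonicSpan g (2 * m)) ∧
        Module.finrank ℝ (NCPoly.symmSubharmonicSpan g (2 * m)) ≤ k * (k + 1) / 2 := by
    intro g k m γ hspan hpriv
    obtain ⟨hγm, w, hw, hγ⟩ := NCPoly.exists_interpolates hspan hpriv
    exact NCPoly.finrank_symmSubharmonicSpan_le hγm hγ hw
  refine ⟨?_, fun m hm hm2 => ?_, fun d hd => ?_⟩
  · intro g d k γ hd hspan hpriv
    obtain ⟨m, rfl⟩ := hd.two_dvd
    rw [Nat.mul_div_cancel_left m two_pos] at hspan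
    obtain ⟨hγm, w, hw, hγ⟩ := NCPoly.exists_interpolates hspan hpriv
    have hsymm : ∀ p : NCPoly (Fin g), p.IsHomogeneous (2 * m) → p.IsSubharmonic →
        p.IsSymmetric → ∃ φ : Matrix (Fin k) (Fin k) ℝ, φ.IsSymm ∧
          p = ∑ i, ∑ j, φ i j • (star (γ i) * γ j) := fun p hp hs hps =>
      NCPoly.exists_isSymm_of_isSubharmonic hγm hγ hw hp hs hps
    -- Without symmetry of `p`, the family `γ` itself interpolates both halves.
    refine ⟨fun p hp hs => ⟨Matrix.of fun i j => _, NCPoly.eq_sum_of_contractions_eq_zero hγm hγm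
      hγ hγ hw hw hp (NCPoly.sum_cf_eq_zero_of_isSubharmonic hp hs)⟩, hsymm,
      fun hstar p hp hs hps => ?_, main hspan hpriv⟩
    obtain ⟨φ, hφ, h⟩ := hsymm p hp hs hps
    refine ⟨φ, hφ, ?_⟩
    simpa only [show ∀ i, star (γ i) = γ i from hstar] using h
  · obtain ⟨γ, -, -, h⟩ := NCPoly.harmonics_two_basis hm hm2
    exact h
  · obtain ⟨m, rfl⟩ := hd.two_dvd
    rcases Nat.eq_zero_or_pos m with rfl | hm
    · obtain ⟨γ, h1, h2⟩ := NCPoly.harmonics_two_zero_basis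
      obtain ⟨h3, h4⟩ := main h1 h2
      exact ⟨h3, fun _ => by omega, fun _ => by omega⟩
    · by_cases hm2 : m = 2
      · subst hm2
        obtain ⟨γ, h1, h2⟩ := NCPoly.harmonics_two_two_basis
        obtain ⟨h3, h4⟩ := main h1 h2
        exact ⟨h3, fun _ => by omega, fun _ => by omega⟩
      · obtain ⟨γ, h1, h2, -⟩ := NCPoly.harmonics_two_basis hm hm2
        obtain ⟨h3, h4⟩ := main h1 h2
        exact ⟨h3, fun _ => by omega, fun _ => by omega⟩
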